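/- Let $Z_1,Z_2,\dots$ be i.i.d. copies of a random element $Z$; let $X$ (covariates) and $Y\in\mathbb R$ (outcome) be measurable functions of $Z$, and write $\|f\|_2=\sqrt{\mathbb E[f(X)^2]}$. Let $\mathcal G,\mathcal A$ be classes of measurable real functions of $x$, let $g_0(x)=\mathbb E[Y\mid X=x]$, and let $a_*,g_*$ be measurable functions (not necessarily equal to $a_0,g_0$). Let $m(z;g)$ be a real-valued moment that is linear in $g$ on the linear span of $\mathcal G\cup\{g_0,g_*\}$, put $\theta(g)=\mathbb E[m(Z;g)]$ and $\theta_0=\theta(g_0)$, and let $a_0$, with $\|a_0\|_2<\infty$, be a Riesz representer of $\theta$: for all $g\in\mathcal G\cup\{g_0\}$, $m(Z;g)$ is integrable and $\theta(g)=\mathbb E[a_0(X)g(X)]$. Let $$m_a(z;g)=m(z;g)+a(x)\,(y-g(x)).$$ For each $n$, partition $\{1,\dots,n\}$ into $K=K_n$ folds $P_1,\dots,P_K$, where $K_n=\Theta(1)$. For each fold $k$ let $\hat a_k\in\mathcal A$ and $\hat g_k\in\mathcal G$ be estimates that are (jointly measurable) functions of the out-of-fold data $(Z_j)_{j\notin P_k}$,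 with $m(z;\hat g_k)$ jointly measurable in the data and $z$, and let $$\hat\theta=\frac1n\sum_{k=1}^K\sum_{i\in P_k}m_{\hat a_k}(Z_i;\hat g_k).$$ Assume the following, where $\mathbb E_X$ and $\|\cdot\|_2$ refer to a fresh copy of $X$, independent of the sample, and the limits are as $n\to\infty$, uniformly in $k\in[K_n]$ (for constant $K$: for each $k\in[K]$). 1. $\sqrt n\,\mathbb E_X[(a_0(X)-\hat a_k(X))(\hat g_k(X)-g_0(X))]\to 0$ in probability. 2. The random variables $\|\hat a_k-a_*\|_2$ and $\|\hat g_k-g_*\|_2$ tend to $0$ in $L^2$, i.e. $\mathbb E[\|\hat a_k-a_*\|_2^2]\to0$ and $\mathbb E[\|\hat g_k-g_*\|_2^2]\to0$. 3. (Mean-squared continuity.) For some constant $M\ge0$, $\sqrt{\mathbb E[m(Z;f)^2]}\le M\|f\|_2$ for all $f=r(g-g')$ with $r\in[0,1]$ and $g,g'\in\mathcal G\cup\{g_*\}$. 4. (Boundedness.) For some constant $C$, almost surely $|Y|\le C$, and $|g(X)|\le C$, $|a(X)|\le C$ almost surely for each $g\in\mathcal G$ and each $a\in\mathcal A$. 5.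 $\sigma_*^2:=\operatorname{Var}(m_{a_*}(Z;g_*))$ is finite, i.e. $m_{a_*}(Z;g_*)$ is square integrable. Then $$\sqrt n\,(\hat\theta-\theta_0)\to_d N(0,\sigma_*^2).$$ -/

import Mathlib

open MeasureTheory ProbabilityTheory Filter Topology Asymptotics
open scoped ENNReal NNReal

noncomputable section

/-- The star hull `{r • f : f ∈ S, r ∈ [0, 1]}` of a class of functions. -/
def starHull {𝒳 : Type*} (S : Set (𝒳 → ℝ)) : Set (𝒳 → ℝ) :=
  {h | ∃ r ∈ Set.Icc (0 : ℝ) 1, ∃ f ∈ S, h = r • f}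

/-- The class `{g - g' : g, g' ∈ S}` of differences of a class of functions. -/
def diffClass {𝒳 : Type*} (S : Set (𝒳 → ℝ)) : Set (𝒳 → ℝ) :=
  {h | ∃ g ∈ S, ∃ g' ∈ S, h = g - g'}

/-- The moment `m(z; g)` is linear in `g` on the linear span of the class `S`. -/
def IsLinearMomentOn {𝒵 𝒳 : Type*} (m : 𝒵 → (𝒳 → ℝ) → ℝ) (S : Set (𝒳 → ℝ)) : Prop :=
  ∀ z : 𝒵, ∀ f ∈ Submodule.span ℝ S, ∀ g ∈ Submodule.span ℝ S, ∀ b c : ℝ,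
    m z (b • f + c • g) = b * m z f + c * m z g

/-- Mean-squared continuity on a class `F`: for some constant `M ≥ 0`,
`√E[m(Z; f)²] ≤ M √E[f(X)²]` for all `f ∈ F`, where `ν` is the law of `Z` and `X = X(Z)`. -/
def MeanSquaredContinuousOn {𝒵 𝒳 : Type*} [MeasurableSpace 𝒵] (ν : Measure 𝒵) (X : 𝒵 → 𝒳)
    (m : 𝒵 → (𝒳 → ℝ) → ℝ) (F : Set (𝒳 → ℝ)) : Prop :=
  ∃ M : ℝ≥0, ∀ f ∈ F,
    eLpNorm (fun z => m z f) 2 ν ≤ (M : ℝ≥0∞) * eLpNorm (fun z => f (X z)) 2 ν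

/-- `g₀` is the regression function `g₀(x) = E[Y | X = x]`. -/
def IsRegressionFunction {𝒵 𝒳 : Type*} [MeasurableSpace 𝒵] [MeasurableSpace 𝒳] (ν : Measure 𝒵)
    (X : 𝒵 → 𝒳) (Y : 𝒵 → ℝ) (g₀ : 𝒳 → ℝ) : Prop :=
  Measurable g₀ ∧
    (fun z => g₀ (X z)) =ᵐ[ν] ν[Y | MeasurableSpace.comap X inferInstance]

/-- The functional `θ(g) = E[m(Z; g)]`. -/
def momentFunctional {𝒵 𝒳 : Type*} [MeasurableSpace 𝒵] (ν : Measure 𝒵)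
    (m : 𝒵 → (𝒳 → ℝ) → ℝ) (g : 𝒳 → ℝ) : ℝ :=
  ∫ z, m z g ∂ν

/-- `a₀` is a (square-integrable) Riesz representer of `θ` on the class `S`:
for all `g ∈ S`, `θ(g)` is well defined and `θ(g) = E[a₀(X) g(X)]`. -/
def IsRieszRepresenter {𝒵 𝒳 : Type*} [MeasurableSpace 𝒵] [MeasurableSpace 𝒳] (ν : Measure 𝒵)
    (X : 𝒵 → 𝒳) (m : 𝒵 → (𝒳 → ℝ) → ℝ) (S : Set (𝒳 → ℝ)) (a₀ : 𝒳 → ℝ) : Prop :=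
  Measurable a₀ ∧ MemLp (fun z => a₀ (X z)) 2 ν ∧
    ∀ g ∈ S, Integrable (fun z => m z g) ν ∧
      momentFunctional ν m g = ∫ z, a₀ (X z) * g (X z) ∂ν

/-- The de-biased moment `m_a(z; g) = m(z; g) + a(x) (y - g(x))`. -/
def debiasedMoment {𝒵 𝒳 : Type*} (X : 𝒵 → 𝒳) (Y : 𝒵 → ℝ) (m : 𝒵 → (𝒳 → ℝ) → ℝ)
    (a g : 𝒳 → ℝ) (z : 𝒵) : ℝ :=
  m z g + a (X z) * (Y z - g (X z))

/-- The out-of-fold data `(Z_j)_{j ∉ P_k}`, where `P_k = {j : fold j = k}`. -/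
def outOfFold {𝒵 : Type*} {n κ : ℕ} (fold : Fin n → Fin κ) (s : Fin n → 𝒵) (k : Fin κ) :
    {j : Fin n // fold j ≠ k} → 𝒵 :=
  fun j => s j

/-- The cross-fitted estimate `(1/n) ∑_k ∑_{i ∈ P_k} m_{â_k}(Z_i; ĝ_k)` computed from the sample
`s = (Z_1, …, Z_n)`, where `â_k` and `ĝ_k` are computed from the out-of-fold data for fold `k`. -/
def crossFitEstimate {𝒵 𝒳 : Type*} (X : 𝒵 → 𝒳) (Y : 𝒵 → ℝ) (m : 𝒵 → (𝒳 → ℝ) → ℝ)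
    {n κ : ℕ} (fold : Fin n → Fin κ)
    (ahat ghat : (k : Fin κ) → ({j : Fin n // fold j ≠ k} → 𝒵) → 𝒳 → ℝ) (s : Fin n → 𝒵) : ℝ :=
  (n : ℝ)⁻¹ * ∑ k : Fin κ, ∑ i : Fin n with fold i = k,
    debiasedMoment X Y m (ahat k (outOfFold fold s k)) (ghat k (outOfFold fold s k)) (s i)

/-- `W n k → 0` in probability as `n → ∞`, uniformly in the fold `k ∈ [K n]`
(the same as for each fold when the number of folds is constant). -/
def TendstoInProbOverFolds {Ω : Type*} [MeasurableSpace Ω] (P : Measure Ω) {K : ℕ → ℕ}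
    (W : (n : ℕ) → Fin (K n) → Ω → ℝ) : Prop :=
  ∀ ε : ℝ, 0 < ε → Tendsto (fun n => ⨆ k : Fin (K n), P {ω | ε ≤ |W n k ω|}) atTop (𝓝 0)

/-- `W n k → 0` in `L²(P)` as `n → ∞`, uniformly in the fold `k ∈ [K n]`
(the same as for each fold when the number of folds is constant). -/
def TendstoInL2OverFolds {Ω : Type*} [MeasurableSpace Ω] (P : Measure Ω) {K : ℕ → ℕ}
    (W : (n : ℕ) → Fin (K n) → Ω → ℝ≥0∞) : Prop :=
  Tendsto (fun n => ⨆ k : Fin (K n), ∫⁻ ω, W n k ω ^ 2 ∂P) atTop (𝓝 0)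

end

/-! Write `ψ` for the limiting moment at `(astar, gstar)` and `μ_k` for the mean of the fitted
moment of fold `k` under a fresh observation. Then `√n (θ̂ - θ₀)` is the sum of three terms:
`n^{-1/2} ∑ (ψ(Z_i) - Eψ)`, the centred sum of fitted moment minus `ψ`, and the fold-weighted bias
`μ_k - θ₀`. Since `Eψ` cancels between the first two, the limits need not be the true nuisances.

The first term obeys the classical central limit theorem. In the second, cross-fitting replaces any
complexity condition on the classes: given the out-of-fold data the fitted function is fixed and the
in-fold observations are i.i.d., so the variance is at most the fold size times a squared `L²`
distance (`lintegral_enorm_sq_sum_folds_le`). That distance vanishes because the moment is Lipschitz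
in the nuisances (`eLpNorm_debiasedMoment_sub_le`). In the third, the Riesz and regression
identities turn `μ_k - θ₀` into the product of the two nuisance errors
(`integral_debiasedMoment_sub_momentFunctional`), which is `o(n^{-1/2})` in probability by
assumption. Slutsky concludes. -/

/-! ### Variance of an i.i.d. sum; boundedness of `L²` limits -/

/-- The squared `L²` norm of a centred sum of i.i.d. variables is at most the number of terms
times the second moment of one term. -/
lemma lintegral_enorm_sq_sum_sub_integral_pi_le {ι 𝒵 : Type*} [Fintype ι] [MeasurableSpace 𝒵]
    (ν : Measure 𝒵) [IsProbabilityMeasure ν] {f : 𝒵 → ℝ} (hf : Measurable f) :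
    ∫⁻ s, ‖∑ i, (f (s i) - ∫ z, f z ∂ν)‖ₑ ^ 2 ∂(Measure.pi fun _ : ι => ν)
      ≤ Fintype.card ι * ∫⁻ z, ‖f z‖ₑ ^ 2 ∂ν := by
  have hnorm : eLpNorm f 2 ν ^ 2 = ∫⁻ z, ‖f z‖ₑ ^ 2 ∂ν := by
    simpa using eLpNorm_nnreal_pow_eq_lintegral (f := f) (μ := ν) (p := 2) (by norm_num)
  by_cases h : MemLp f 2 ν
  · have hint : Integrable f ν := h.integrable one_le_two
    set g : ι → 𝒵 → ℝ := fun _ z => f z - ∫ z, f z ∂ν with hg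
    have hgL : ∀ i, MemLp (g i) 2 ν := fun i => h.sub (memLp_const _)
    have hmean : ∫ s, (∑ i, fun s : ι → 𝒵 => g i (s i)) s ∂(Measure.pi fun _ : ι => ν) = 0 := by
      simp only [Finset.sum_apply]
      rw [integral_finsetSum]
      · refine Finset.sum_eq_zero fun i _ => ?_
        have hmp := measurePreserving_eval (fun _ : ι => ν) i
        have e := integral_map (μ := Measure.pi fun _ : ι => ν) hmp.aemeasurable (f := g i)
          (by rw [hmp.map_eq]; exact (hgL i).aestronglyMeasurable)
        rw [hmp.map_eq] at e
        simp only [Function.eval] at e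
        rw [← e]
        simp [hg, integral_sub hint (integrable_const _)]
      · intro i _
        exact (measurePreserving_eval (fun _ : ι => ν) i).integrable_comp_of_integrable
          ((hgL i).integrable one_le_two)
    have hv := variance_sum_pi (μ := fun _ : ι => ν) (X := g) hgL
    have hmem : MemLp (∑ i, fun s : ι → 𝒵 => g i (s i)) 2 (Measure.pi fun _ : ι => ν) :=
      memLp_finsetSum' _ fun i _ =>
        (hgL i).comp_measurePreserving (measurePreserving_eval (fun _ : ι => ν) i)
    have he := hmem.ofReal_variance_eq
    rw [evariance, hmean, hv] at he
    have hle : ∀ i, Var[g i; ν] ≤ ∫ z, f z ^ 2 ∂ν := by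
      intro i
      rw [hg, variance_sub_const hf.aestronglyMeasurable]
      exact variance_le_expectation_sq hf.aestronglyMeasurable
    have hsq : ∫⁻ z, ‖f z‖ₑ ^ 2 ∂ν = ENNReal.ofReal (∫ z, f z ^ 2 ∂ν) := by
      rw [ofReal_integral_eq_lintegral_ofReal h.integrable_sq (ae_of_all _ fun _ => sq_nonneg _)]
      refine lintegral_congr fun z => ?_
      rw [← enorm_pow, Real.enorm_of_nonneg (sq_nonneg _)]
    calc _ = ENNReal.ofReal (∑ i, Var[g i; ν]) := by
            rw [he]; simp [hg, Finset.sum_apply]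
      _ ≤ ENNReal.ofReal (Fintype.card ι * ∫ z, f z ^ 2 ∂ν) := by
            refine ENNReal.ofReal_le_ofReal ?_
            simpa using Finset.sum_le_sum fun i (_ : i ∈ Finset.univ) => hle i
      _ = _ := by
            rw [ENNReal.ofReal_mul (by positivity), hsq]; simp
  -- Outside `L²` the right side is infinite, except for the empty sum, where both sides vanish.
  · rcases isEmpty_or_nonempty ι with hι | hι
    · simp
    · have : eLpNorm f 2 ν = ∞ := by
        by_contra hc
        exact h ⟨hf.aestronglyMeasurable, lt_top_iff_ne_top.2 hc⟩
      rw [← hnorm, this]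
      simp [ENNReal.mul_top]

/-- An `L²` limit of functions bounded by `C` is bounded
by `C` almost everywhere. -/
lemma ae_abs_le_of_forall_exists_eLpNorm_lt {α : Type*} [MeasurableSpace α] {μ : Measure α}
    {h : α → ℝ} {C : ℝ} (hh : Measurable h)
    (happrox : ∀ ε : ℝ≥0∞, 0 < ε → ∃ f : α → ℝ, Measurable f ∧ (∀ᵐ x ∂μ, |f x| ≤ C) ∧
      eLpNorm (fun x => f x - h x) 2 μ < ε) :
    ∀ᵐ x ∂μ, |h x| ≤ C := by
  choose f hfm hfC hfε using fun n : ℕ => happrox ((n : ℝ≥0∞) + 1)⁻¹ (by simp)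
  have hlim : Tendsto (fun n => eLpNorm (f n - h) 2 μ) atTop (𝓝 0) := by
    refine tendsto_of_tendsto_of_tendsto_of_le_of_le tendsto_const_nhds
      (h := fun n : ℕ => ((n : ℝ≥0∞) + 1)⁻¹) ?_ (fun n => zero_le) (fun n => (hfε n).le)
    simpa using (tendsto_add_atTop_iff_nat 1).2 ENNReal.tendsto_inv_nat_nhds_zero
  obtain ⟨ns, -, hns⟩ := (tendstoInMeasure_of_tendsto_eLpNorm (by norm_num)
    (fun n => (hfm n).aestronglyMeasurable) hh.aestronglyMeasurable hlim).exists_seq_tendsto_ae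
  filter_upwards [hns, ae_all_iff.2 hfC] with x hx hxC
  exact le_of_tendsto hx.abs (Eventually.of_forall fun n => hxC _)

/-! ### Second moments under sample splitting -/

/-- The sum over the coordinates in a fold of a function fitted on the other coordinates, centred
by its mean under a fresh observation. -/
lemma lintegral_enorm_sq_sum_split_le {ι 𝒵 : Type*} [Fintype ι] [MeasurableSpace 𝒵]
    (ν : Measure 𝒵) [IsProbabilityMeasure ν] (p : ι → Prop) [DecidablePred p]
    {F : ({j : ι // p j} → 𝒵) → 𝒵 → ℝ} (hF : Measurable (Function.uncurry F)) :
    ∫⁻ s, ‖∑ i : {j : ι // ¬ p j}, (F (fun j => s j) (s i) - ∫ z, F (fun j => s j) z ∂ν)‖ₑ ^ 2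
        ∂(Measure.pi fun _ : ι => ν)
      ≤ Fintype.card {j : ι // ¬ p j} *
        ∫⁻ s, ∫⁻ z, ‖F (fun j => s j) z‖ₑ ^ 2 ∂ν ∂(Measure.pi fun _ : ι => ν) := by
  have hmp := measurePreserving_piEquivPiSubtypeProd (fun _ : ι => ν) p
  have hmean : Measurable fun d => ∫ z, F d z ∂ν :=
    (hF.stronglyMeasurable.integral_prod_right).measurable
  have hG : Measurable fun q : ({j : ι // p j} → 𝒵) × ({j : ι // ¬ p j} → 𝒵) =>
      ‖∑ i, (F q.1 (q.2 i) - ∫ z, F q.1 z ∂ν)‖ₑ ^ 2 := by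
    have h1 : ∀ i, Measurable fun q : ({j : ι // p j} → 𝒵) × ({j : ι // ¬ p j} → 𝒵) =>
        F q.1 (q.2 i) := fun i =>
      hF.comp (measurable_fst.prodMk ((measurable_pi_apply i).comp measurable_snd))
    have h2 : Measurable fun q : ({j : ι // p j} → 𝒵) × ({j : ι // ¬ p j} → 𝒵) =>
        ∫ z, F q.1 z ∂ν := hmean.comp measurable_fst
    exact ((Finset.measurable_fun_sum _ fun i _ => (h1 i).sub h2).enorm).pow_const 2
  have hH : Measurable fun d => ∫⁻ z, ‖F d z‖ₑ ^ 2 ∂ν :=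
    Measurable.lintegral_prod_right (f := fun d z => ‖F d z‖ₑ ^ 2)
      (hF.enorm.pow_const 2)
  have e1 := hmp.lintegral_comp hG
  have e2 := (measurePreserving_fst.comp hmp).lintegral_comp hH
  -- The two blocks of coordinates are independent, so Tonelli freezes the fitting block at `d` and
  -- the i.i.d. bound applies to the fixed function `F d`.
  calc _ = _ := e1
    _ = ∫⁻ d, ∫⁻ s, ‖∑ i, (F d (s i) - ∫ z, F d z ∂ν)‖ₑ ^ 2
          ∂(Measure.pi fun _ : {j : ι // ¬ p j} => ν)
          ∂(Measure.pi fun _ : {j : ι // p j} => ν) := lintegral_prod _ hG.aemeasurable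
    _ ≤ ∫⁻ d, Fintype.card {j : ι // ¬ p j} * ∫⁻ z, ‖F d z‖ₑ ^ 2 ∂ν
          ∂(Measure.pi fun _ : {j : ι // p j} => ν) :=
        lintegral_mono fun d => lintegral_enorm_sq_sum_sub_integral_pi_le ν
          (hF.comp measurable_prodMk_left)
    _ = _ := by
        rw [lintegral_const_mul _ hH, ← e2]; rfl

/-- Cauchy–Schwarz. Sums over different folds are dependent, each fit using the other folds' data,
so orthogonality is not available; the price is a factor equal to the number of folds. -/
lemma enorm_sum_sq_le_card_mul_sum_enorm_sq {ι : Type*} [Fintype ι] (x : ι → ℝ) :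
    ‖∑ i, x i‖ₑ ^ 2 ≤ Fintype.card ι * ∑ i, ‖x i‖ₑ ^ 2 := by
  have h (y : ℝ) : ‖y‖ₑ ^ 2 = ENNReal.ofReal (y ^ 2) := by
    rw [← enorm_pow, Real.enorm_of_nonneg (sq_nonneg _)]
  simp only [h]
  rw [← ENNReal.ofReal_sum_of_nonneg fun i _ => sq_nonneg _, ← ENNReal.ofReal_natCast,
    ← ENNReal.ofReal_mul (by positivity)]
  exact ENNReal.ofReal_le_ofReal (by simpa using sq_sum_le_card_mul_sum_sq (s := Finset.univ))

lemma measurable_outOfFold {𝒵 : Type*} [MeasurableSpace 𝒵] {n κ : ℕ} (fold : Fin n → Fin κ)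
    (k : Fin κ) : Measurable fun s : Fin n → 𝒵 => outOfFold fold s k :=
  measurable_pi_lambda _ fun _ => measurable_pi_apply _

/-- Second moment bound for the cross-fitted empirical process. -/
lemma lintegral_enorm_sq_sum_folds_le {𝒵 : Type*} [MeasurableSpace 𝒵]
    (ν : Measure 𝒵) [IsProbabilityMeasure ν] {n κ : ℕ} (fold : Fin n → Fin κ)
    {F : (k : Fin κ) → ({j : Fin n // fold j ≠ k} → 𝒵) → 𝒵 → ℝ}
    (hF : ∀ k, Measurable (Function.uncurry (F k))) {δ : ℝ≥0∞}
    (hδ : ∀ k, ∫⁻ s, ∫⁻ z, ‖F k (outOfFold fold s k) z‖ₑ ^ 2 ∂ν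
      ∂(Measure.pi fun _ : Fin n => ν) ≤ δ) :
    ∫⁻ s, ‖∑ k, ∑ i with fold i = k, (F k (outOfFold fold s k) (s i)
        - ∫ z, F k (outOfFold fold s k) z ∂ν)‖ₑ ^ 2 ∂(Measure.pi fun _ : Fin n => ν)
      ≤ κ * (n * δ) := by
  have hsub (k : Fin κ) (h : Fin n → ℝ) :
      ∑ i with fold i = k, h i = ∑ i : {j : Fin n // ¬ fold j ≠ k}, h i :=
    Finset.sum_subtype _ (by simp) h
  have hcard (k : Fin κ) :
      Fintype.card {j : Fin n // ¬ fold j ≠ k} = (Finset.univ.filter fun i => fold i = k).card := by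
    simp [Fintype.card_subtype]
  have hmeas (k : Fin κ) : Measurable fun s : Fin n → 𝒵 =>
      ‖∑ i with fold i = k, (F k (outOfFold fold s k) (s i)
        - ∫ z, F k (outOfFold fold s k) z ∂ν)‖ₑ ^ 2 := by
    have h1 (i : Fin n) : Measurable fun s : Fin n → 𝒵 => F k (outOfFold fold s k) (s i) :=
      (hF k).comp ((measurable_outOfFold fold k).prodMk (measurable_pi_apply i))
    have h2 : Measurable fun s : Fin n → 𝒵 => ∫ z, F k (outOfFold fold s k) z ∂ν :=
      ((hF k).stronglyMeasurable.integral_prod_right).measurable.comp (measurable_outOfFold fold k)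
    exact ((Finset.measurable_fun_sum _ fun i _ => (h1 i).sub h2).enorm).pow_const 2
  calc _ ≤ ∫⁻ s, κ * ∑ k, ‖∑ i with fold i = k, (F k (outOfFold fold s k) (s i)
        - ∫ z, F k (outOfFold fold s k) z ∂ν)‖ₑ ^ 2 ∂(Measure.pi fun _ : Fin n => ν) := by
        refine lintegral_mono fun s => ?_
        simpa using enorm_sum_sq_le_card_mul_sum_enorm_sq
          fun k => ∑ i with fold i = k, (F k (outOfFold fold s k) (s i)
            - ∫ z, F k (outOfFold fold s k) z ∂ν)
    _ = κ * ∑ k, ∫⁻ s, ‖∑ i with fold i = k, (F k (outOfFold fold s k) (s i)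
        - ∫ z, F k (outOfFold fold s k) z ∂ν)‖ₑ ^ 2 ∂(Measure.pi fun _ : Fin n => ν) := by
        rw [lintegral_const_mul _ (Finset.measurable_fun_sum _ fun k _ => hmeas k),
          lintegral_finsetSum _ fun k _ => hmeas k]
    _ ≤ κ * ∑ k, (Finset.univ.filter fun i => fold i = k).card * δ := by
        gcongr with k
        simp only [hsub k]
        refine (lintegral_enorm_sq_sum_split_le ν (fun j => fold j ≠ k) (hF k)).trans ?_
        rw [hcard k]
        gcongr
        exact hδ k
    _ = κ * (n * δ) := by
        rw [← Finset.sum_mul, ← Nat.cast_sum, Finset.sum_card_fiberwise_eq_card_filter]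
        simp

/-! ### Bias and continuity of the de-biased moment -/

/-- Mixed bias: the error of the mean of the de-biased moment is a product of errors. -/
lemma integral_debiasedMoment_sub_momentFunctional {𝒵 𝒳 : Type*} [MeasurableSpace 𝒵]
    [MeasurableSpace 𝒳] {ν : Measure 𝒵} [IsProbabilityMeasure ν] {X : 𝒵 → 𝒳} (hX : Measurable X)
    {Y : 𝒵 → ℝ} (hY : MemLp Y 2 ν) {S : Set (𝒳 → ℝ)} {m : 𝒵 → (𝒳 → ℝ) → ℝ}
    {g₀ a₀ a g : 𝒳 → ℝ} {C : ℝ} (hg₀ : IsRegressionFunction ν X Y g₀)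
    (ha₀ : IsRieszRepresenter ν X m (insert g₀ S) a₀) (hg : g ∈ S)
    (ha : Measurable a) (haC : ∀ᵐ z ∂ν, |a (X z)| ≤ C) (hgL : MemLp (fun z => g (X z)) 2 ν) :
    Integrable (debiasedMoment X Y m a g) ν ∧
    ∫ z, debiasedMoment X Y m a g z ∂ν - momentFunctional ν m g₀
      = ∫ z, (a₀ (X z) - a (X z)) * (g (X z) - g₀ (X z)) ∂ν := by
  obtain ⟨hmg, hθg⟩ := ha₀.2.2 g (Set.mem_insert_of_mem _ hg)
  obtain ⟨hmg₀, hθg₀⟩ := ha₀.2.2 g₀ (Set.mem_insert _ _)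
  have hg₀L : MemLp (fun z => g₀ (X z)) 2 ν := by
    rw [memLp_congr_ae hg₀.2]
    exact hY.condExp one_le_two
  have haL : MemLp (fun z => a (X z)) 2 ν :=
    MemLp.of_bound (ha.comp hX).aestronglyMeasurable C haC
  have i1 : Integrable (fun z => a₀ (X z) * g (X z)) ν := ha₀.2.1.integrable_mul hgL
  have i2 : Integrable (fun z => a₀ (X z) * g₀ (X z)) ν := ha₀.2.1.integrable_mul hg₀L
  have i3 : Integrable (fun z => a (X z) * g (X z)) ν := haL.integrable_mul hgL
  have i4 : Integrable (fun z => a (X z) * g₀ (X z)) ν := haL.integrable_mul hg₀L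
  have i5 : Integrable (fun z => a (X z) * Y z) ν := haL.integrable_mul hY
  -- Tower property: `a(X)` is pulled out of the conditional expectation given `X`.
  have hcond : ∫ z, a (X z) * Y z ∂ν = ∫ z, a (X z) * g₀ (X z) ∂ν := by
    have hle : MeasurableSpace.comap X inferInstance ≤ (inferInstance : MeasurableSpace 𝒵) :=
      hX.comap_le
    rw [← integral_condExp hle (f := fun z => a (X z) * Y z)]
    refine integral_congr_ae ?_
    have := condExp_mul_of_aestronglyMeasurable_left (μ := ν)
      (m := MeasurableSpace.comap X inferInstance) (f := fun z => a (X z)) (g := Y)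
      (ha.comp (comap_measurable X)).stronglyMeasurable.aestronglyMeasurable i5
      (hY.integrable one_le_two)
    filter_upwards [this, hg₀.2] with z h1 h2
    rw [h2]
    exact h1
  have hdm : debiasedMoment X Y m a g = fun z => m z g + (a (X z) * Y z - a (X z) * g (X z)) := by
    ext z; simp only [debiasedMoment]; ring
  refine ⟨by rw [hdm]; exact hmg.add (i5.sub i3), ?_⟩
  have hr : (fun z => (a₀ (X z) - a (X z)) * (g (X z) - g₀ (X z))) = fun z =>
      (a₀ (X z) * g (X z) - a₀ (X z) * g₀ (X z)) -
        (a (X z) * g (X z) - a (X z) * g₀ (X z)) := by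
    ext z; ring
  have i53 : Integrable (fun z => a (X z) * Y z - a (X z) * g (X z)) ν := i5.sub i3
  have i12 : Integrable (fun z => a₀ (X z) * g (X z) - a₀ (X z) * g₀ (X z)) ν := i1.sub i2
  have i34 : Integrable (fun z => a (X z) * g (X z) - a (X z) * g₀ (X z)) ν := i3.sub i4
  rw [hdm, hr, integral_add hmg i53, integral_sub i5 i3, integral_sub i12 i34, integral_sub i1 i2, integral_sub i3 i4, hcond, hθg₀, ← hθg]
  simp only [momentFunctional]
  ring

/-- The de-biased moment is `L²`-Lipschitz in the nuisance functions. -/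
lemma eLpNorm_debiasedMoment_sub_le {𝒵 𝒳 : Type*} [MeasurableSpace 𝒵]
    [MeasurableSpace 𝒳] {ν : Measure 𝒵} {X : 𝒵 → 𝒳} (hX : Measurable X)
    {Y : 𝒵 → ℝ} (hY : Measurable Y) {m : 𝒵 → (𝒳 → ℝ) → ℝ} {a g a' g' : 𝒳 → ℝ} {C M : ℝ≥0}
    (ha : Measurable a) (hg : Measurable g) (ha' : Measurable a') (hg' : Measurable g')
    (hYC : ∀ᵐ z ∂ν, |Y z| ≤ C) (hgC : ∀ᵐ z ∂ν, |g (X z)| ≤ C) (haC : ∀ᵐ z ∂ν, |a' (X z)| ≤ C)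
    (hm : AEStronglyMeasurable (fun z => m z g) ν)
    (hm' : AEStronglyMeasurable (fun z => m z g') ν)
    (hM : eLpNorm (fun z => m z g - m z g') 2 ν ≤ M * eLpNorm (fun z => g (X z) - g' (X z)) 2 ν) :
    eLpNorm (fun z => debiasedMoment X Y m a g z - debiasedMoment X Y m a' g' z) 2 ν
      ≤ (M + C : ℝ≥0) * eLpNorm (fun z => g (X z) - g' (X z)) 2 ν
        + (2 * C : ℝ≥0) * eLpNorm (fun z => a (X z) - a' (X z)) 2 ν := by
  have haX := ha.comp hX
  have hgX := hg.comp hX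
  have haX' := ha'.comp hX
  have hgX' := hg'.comp hX
  have b1 : eLpNorm (fun z => (a (X z) - a' (X z)) * (Y z - g (X z))) 2 ν
      ≤ (2 * C : ℝ≥0) * eLpNorm (fun z => a (X z) - a' (X z)) 2 ν := by
    have := eLpNorm_le_mul_eLpNorm_of_ae_le_mul (μ := ν) (c := 2 * C)
      (f := fun z => (a (X z) - a' (X z)) * (Y z - g (X z)))
      (g := fun z => a (X z) - a' (X z)) ?_ 2
    · simpa [ENNReal.ofReal_mul] using this
    · filter_upwards [hYC, hgC] with z h1 h2
      rw [norm_mul, mul_comm]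
      gcongr
      calc |Y z - g (X z)| ≤ |Y z| + |g (X z)| := abs_sub _ _
        _ ≤ 2 * C := by linarith
  have b2 : eLpNorm (fun z => a' (X z) * (g' (X z) - g (X z))) 2 ν
      ≤ C * eLpNorm (fun z => g (X z) - g' (X z)) 2 ν := by
    have := eLpNorm_le_mul_eLpNorm_of_ae_le_mul (μ := ν) (c := C)
      (f := fun z => a' (X z) * (g' (X z) - g (X z)))
      (g := fun z => g (X z) - g' (X z)) ?_ 2
    · simpa using this
    · filter_upwards [haC] with z h1
      rw [norm_mul, norm_sub_rev (g' (X z))]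
      gcongr
      exact h1
  -- The pivot is `a' (Y - g)`: this way only `Y`, `g` and `a'` have to be bounded, not `g'`, which
  -- will be the limit `gstar`.
  have hsplit : (fun z => debiasedMoment X Y m a g z - debiasedMoment X Y m a' g' z)
      = ((fun z => m z g - m z g') + fun z => a' (X z) * (g' (X z) - g (X z)))
        + fun z => (a (X z) - a' (X z)) * (Y z - g (X z)) := by
    ext z
    simp only [debiasedMoment, Pi.add_apply]
    ring
  have m1 : AEStronglyMeasurable (fun z => m z g - m z g') ν := hm.sub hm'
  have m2 : AEStronglyMeasurable (fun z => a' (X z) * (g' (X z) - g (X z))) ν :=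
    (haX'.mul (hgX'.sub hgX)).aestronglyMeasurable
  have m3 : AEStronglyMeasurable (fun z => (a (X z) - a' (X z)) * (Y z - g (X z))) ν :=
    ((haX.sub haX').mul (hY.sub hgX)).aestronglyMeasurable
  rw [hsplit]
  refine (eLpNorm_add_le (m1.add m2) m3 one_le_two).trans ?_
  refine (add_le_add ((eLpNorm_add_le m1 m2 one_le_two).trans (add_le_add hM b2)) b1).trans ?_
  rw [ENNReal.coe_add, add_mul]

/-! ### Error decomposition and convergence over folds -/

lemma sum_folds_eq_sum {n κ : ℕ} (fold : Fin n → Fin κ) (c : Fin n → ℝ) :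
    ∑ k, ∑ i with fold i = k, c i = ∑ i, c i :=
  Finset.sum_fiberwise _ _ _

/-- Decomposition of the cross-fitted error into the oracle empirical mean, a centred empirical
process, and a bias term. -/
lemma sqrt_mul_crossFit_decomposition {n κ : ℕ} (fold : Fin n → Fin κ) (D : Fin κ → Fin n → ℝ)
    (ψ : Fin n → ℝ) (μ : Fin κ → ℝ) (θ e : ℝ) :
    √(n : ℝ) * ((n : ℝ)⁻¹ * ∑ k, ∑ i with fold i = k, D k i - θ) - (√(n : ℝ))⁻¹ *
        (∑ i, ψ i - n * e)
      = (√(n : ℝ))⁻¹ * ∑ k, ∑ i with fold i = k, (D k i - ψ i - (μ k - e))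
        + (√(n : ℝ))⁻¹ * ∑ k, ∑ i with fold i = k, (μ k - θ) := by
  rcases Nat.eq_zero_or_pos n with rfl | hn
  · simp
  have hs : 0 < √(n : ℝ) := by positivity
  have hs2 : √(n : ℝ) ^ 2 = n := Real.sq_sqrt (by positivity)
  have h (c : ℝ) : ∑ k, ∑ i with fold i = k, c = n * c := by
    rw [sum_folds_eq_sum fold fun _ => c]; simp
  have key : ∑ k, ∑ i with fold i = k, (D k i - ψ i - (μ k - e))
      + ∑ k, ∑ i with fold i = k, (μ k - θ)
      = ∑ k, ∑ i with fold i = k, D k i - n * θ - (∑ i, ψ i - n * e) := by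
    rw [← h θ, ← h e, ← sum_folds_eq_sum fold ψ]
    simp only [← Finset.sum_add_distrib, ← Finset.sum_sub_distrib]
    refine Finset.sum_congr rfl fun k _ => Finset.sum_congr rfl fun i _ => by ring
  rw [← mul_add, key]
  field_simp
  rw [hs2]
  field_simp

lemma tendstoInMeasure_zero_of_tendsto_lintegral_enorm_sq {Ω : Type*} [MeasurableSpace Ω]
    {P : Measure Ω} {R : ℕ → Ω → ℝ} (hR : ∀ n, AEStronglyMeasurable (R n) P)
    (h : Tendsto (fun n => ∫⁻ ω, ‖R n ω‖ₑ ^ 2 ∂P) atTop (𝓝 0)) :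
    TendstoInMeasure P R atTop 0 := by
  refine tendstoInMeasure_of_tendsto_eLpNorm (p := 2) (by norm_num) hR
    aestronglyMeasurable_zero ?_
  have hn (n : ℕ) : eLpNorm (R n - 0) 2 P = (∫⁻ ω, ‖R n ω‖ₑ ^ 2 ∂P) ^ ((1 : ℝ) / 2) := by
    rw [sub_zero, eLpNorm_eq_lintegral_rpow_enorm_toReal (by norm_num) (by norm_num)]
    simp
  simp only [hn]
  have := (ENNReal.continuous_rpow_const (y := (1 : ℝ) / 2)).tendsto 0
  rw [ENNReal.zero_rpow_of_pos (by norm_num)] at this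
  exact this.comp h

/-- A weighted average over a bounded number of folds of quantities that vanish in probability
vanishes in probability. -/
lemma tendstoInMeasure_sum_folds {Ω : Type*} [MeasurableSpace Ω] {P : Measure Ω} {K : ℕ → ℕ}
    {B : ℕ} (hK : ∀ᶠ n in atTop, K n ≤ B) (fold : (n : ℕ) → Fin n → Fin (K n))
    {b : (n : ℕ) → Fin (K n) → Ω → ℝ}
    (hb : TendstoInProbOverFolds P fun (n : ℕ) k ω => √(n : ℝ) * b n k ω) :
    TendstoInMeasure P
      (fun (n : ℕ) ω => (√(n : ℝ))⁻¹ * ∑ k, ∑ i with fold n i = k, b n k ω) atTop 0 := by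
  rw [tendstoInMeasure_iff_norm]
  intro ε hε
  -- Halving `ε` leaves a strict gap: if every fold is below `ε / 2`, the weighted average is at
  -- most `ε / 2 < ε`. A union bound over at most `B` folds then suffices.
  have hlim := ENNReal.Tendsto.const_mul (a := (B : ℝ≥0∞)) (hb (ε / 2) (by positivity))
    (Or.inr (by simp))
  rw [mul_zero] at hlim
  refine tendsto_of_tendsto_of_tendsto_of_le_of_le' tendsto_const_nhds hlim
    (Eventually.of_forall fun n => zero_le) ?_
  filter_upwards [hK, eventually_gt_atTop 0] with n hn hn0
  have hs : 0 < √(n : ℝ) := by positivity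
  calc _ ≤ P (⋃ k, {ω | ε / 2 ≤ |√(n : ℝ) * b n k ω|}) := by
        refine measure_mono fun ω hω => ?_
        by_contra hc
        simp only [Set.mem_iUnion, Set.mem_ofPred_eq, not_exists, not_le] at hc hω
        have hle (k : Fin (K n)) : |b n k ω| ≤ (√(n : ℝ))⁻¹ * (ε / 2) := by
          have := (hc k).le
          rw [abs_mul, abs_of_pos hs] at this
          rwa [inv_mul_eq_div, le_div_iff₀ hs, mul_comm]
        have h1 : |∑ k, ∑ i with fold n i = k, b n k ω| ≤ n * ((√(n : ℝ))⁻¹ * (ε / 2)) := by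
          calc _ ≤ ∑ k, ∑ i with fold n i = k, |b n k ω| :=
                (Finset.abs_sum_le_sum_abs _ _).trans
                  (Finset.sum_le_sum fun k _ => Finset.abs_sum_le_sum_abs _ _)
            _ ≤ ∑ k, ∑ i with fold n i = k, (√(n : ℝ))⁻¹ * (ε / 2) :=
                Finset.sum_le_sum fun k _ => Finset.sum_le_sum fun i _ => hle k
            _ = _ := by
                rw [sum_folds_eq_sum (fold n) fun _ => (√(n : ℝ))⁻¹ * (ε / 2)]; simp
        have h2 : (√(n : ℝ))⁻¹ * (n * ((√(n : ℝ))⁻¹ * (ε / 2))) = ε / 2 := by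
          have hs2 : √(n : ℝ) ^ 2 = n := Real.sq_sqrt (by positivity)
          field_simp
          rw [hs2]
        rw [Pi.zero_apply, sub_zero, Real.norm_eq_abs, abs_mul, abs_of_pos (inv_pos.2 hs)] at hω
        have h3 := mul_le_mul_of_nonneg_left h1 (inv_pos.2 hs).le
        linarith
    _ ≤ ∑ k, P {ω | ε / 2 ≤ |√(n : ℝ) * b n k ω|} := measure_iUnion_fintype_le _ _
    _ ≤ ∑ k : Fin (K n), ⨆ k : Fin (K n), P {ω | ε / 2 ≤ |√(n : ℝ) * b n k ω|} :=
        Finset.sum_le_sum fun k _ =>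
          le_iSup (fun k : Fin (K n) => P {ω | ε / 2 ≤ |√(n : ℝ) * b n k ω|}) k
    _ = K n * ⨆ k : Fin (K n), P {ω | ε / 2 ≤ |√(n : ℝ) * b n k ω|} := by simp
    _ ≤ _ := by gcongr

/-- An `L²` limit over folds is approximated by realised estimates. -/
lemma TendstoInL2OverFolds.exists_lt {Ω : Type*} [MeasurableSpace Ω] {P : Measure Ω}
    [IsProbabilityMeasure P] {K : ℕ → ℕ} (fold : (n : ℕ) → Fin n → Fin (K n))
    {W : (n : ℕ) → Fin (K n) → Ω → ℝ≥0∞} (h : TendstoInL2OverFolds P W)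
    {ε : ℝ≥0∞} (hε : 0 < ε) : ∃ n k ω, W n k ω < ε := by
  have hε2 : 0 < ε ^ 2 := by positivity
  obtain ⟨n, hn, hn0⟩ :=
    ((h.eventually_lt_const hε2).and (eventually_gt_atTop 0)).exists
  -- The fold of the first index shows that some fold exists; over no folds the supremum would be
  -- `0` and carry no information.
  let k := fold n ⟨0, hn0⟩
  refine ⟨n, k, ?_⟩
  by_contra! hc
  refine absurd hn (not_lt.2 ?_)
  calc ε ^ 2 = ∫⁻ _, ε ^ 2 ∂P := by simp
    _ ≤ ∫⁻ ω, W n k ω ^ 2 ∂P := lintegral_mono fun ω => by gcongr; exact hc ω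
    _ ≤ _ := le_iSup (fun k : Fin (K n) => ∫⁻ ω, W n k ω ^ 2 ∂P) k

/-- Expected squared `L²` norms inherit a triangle-type bound on `L²` norms. -/
lemma lintegral_lintegral_enorm_sq_le {Ω D 𝒵 : Type*} [MeasurableSpace Ω] [MeasurableSpace D]
    [MeasurableSpace 𝒵] {P : Measure Ω} {ν : Measure 𝒵} [SFinite ν] {T : Ω → D}
    (hT : AEMeasurable T P) {F G H : D → 𝒵 → ℝ} (hG : Measurable (Function.uncurry G))
    {A B : ℝ≥0}
    (hle : ∀ d, eLpNorm (F d) 2 ν ≤ A * eLpNorm (G d) 2 ν + B * eLpNorm (H d) 2 ν) :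
    ∫⁻ ω, ∫⁻ z, ‖F (T ω) z‖ₑ ^ 2 ∂ν ∂P
      ≤ 2 * A ^ 2 * ∫⁻ ω, eLpNorm (G (T ω)) 2 ν ^ 2 ∂P
        + 2 * B ^ 2 * ∫⁻ ω, eLpNorm (H (T ω)) 2 ν ^ 2 ∂P := by
  have hnorm (f : 𝒵 → ℝ) : eLpNorm f 2 ν ^ 2 = ∫⁻ z, ‖f z‖ₑ ^ 2 ∂ν := by
    simpa using eLpNorm_nnreal_pow_eq_lintegral (f := f) (μ := ν) (p := 2) (by norm_num)
  have hGm : AEMeasurable (fun ω => 2 * (A : ℝ≥0∞) ^ 2 * eLpNorm (G (T ω)) 2 ν ^ 2) P := by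
    have : Measurable fun d => ∫⁻ z, ‖G d z‖ₑ ^ 2 ∂ν :=
      Measurable.lintegral_prod_right (f := fun d z => ‖G d z‖ₑ ^ 2) (hG.enorm.pow_const 2)
    simp only [hnorm]
    exact (this.comp_aemeasurable hT).const_mul _
  rw [← lintegral_const_mul' _ _ (by finiteness), ← lintegral_const_mul' _ _ (by finiteness),
    ← lintegral_add_left' hGm]
  refine lintegral_mono fun ω => ?_
  rw [← hnorm]
  have hsq (a b : ℝ≥0∞) : (a + b) ^ 2 ≤ 2 * a ^ 2 + 2 * b ^ 2 := by
    have := ENNReal.rpow_add_le_mul_rpow_add_rpow a b (p := 2) (by norm_num)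
    norm_num at this
    rwa [mul_add] at this
  calc _ ≤ (A * eLpNorm (G (T ω)) 2 ν + B * eLpNorm (H (T ω)) 2 ν) ^ 2 := by
        gcongr; exact hle _
    _ ≤ _ := hsq _ _
    _ = _ := by simp only [mul_pow, mul_assoc]

/-! ### Asymptotic normality -/

theorem mainTheorem7
    {Ω 𝒵 𝒳 : Type*} [MeasurableSpace Ω] [MeasurableSpace 𝒵] [MeasurableSpace 𝒳]
    -- i.i.d. observations `Z_i` with law `ν`; covariates `X` and outcome `Y` are parts of `Z`
    (P : Measure Ω) [IsProbabilityMeasure P] (ν : Measure 𝒵) [IsProbabilityMeasure ν]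
    (Z : ℕ → Ω → 𝒵) (hZlaw : ∀ i, HasLaw (Z i) ν P) (hZindep : iIndepFun Z P)
    (X : 𝒵 → 𝒳) (hX : Measurable X) (Y : 𝒵 → ℝ) (hY : Measurable Y)
    -- the function classes, the moment, the regression function and the Riesz representer
    (𝒜 𝒢 : Set (𝒳 → ℝ)) (h𝒜 : ∀ a ∈ 𝒜, Measurable a) (h𝒢 : ∀ g ∈ 𝒢, Measurable g)
    (m : 𝒵 → (𝒳 → ℝ) → ℝ) (g₀ a₀ gstar astar : 𝒳 → ℝ)
    (hlin : IsLinearMomentOn m (𝒢 ∪ {g₀, gstar}))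
    (hg₀ : IsRegressionFunction ν X Y g₀)
    (ha₀ : IsRieszRepresenter ν X m (insert g₀ 𝒢) a₀)
    -- the folds and the nuisance estimators, which are functions of the out-of-fold data
    (K : ℕ → ℕ) (hK : (fun n => (K n : ℝ)) =Θ[atTop] (fun _ => (1 : ℝ)))
    (fold : (n : ℕ) → Fin n → Fin (K n))
    (ahat ghat : (n : ℕ) → (k : Fin (K n)) → ({j : Fin n // fold n j ≠ k} → 𝒵) → 𝒳 → ℝ)
    (hahat_mem : ∀ n k d, ahat n k d ∈ 𝒜) (hghat_mem : ∀ n k d, ghat n k d ∈ 𝒢)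
    (hahat_meas : ∀ n k, Measurable (Function.uncurry (ahat n k)))
    (hghat_meas : ∀ n k, Measurable (Function.uncurry (ghat n k)))
    (hm_meas : ∀ n k, Measurable
      (fun p : ({j : Fin n // fold n j ≠ k} → 𝒵) × 𝒵 => m p.2 (ghat n k p.1)))
    -- `√n E_X[(a₀(X) - â_k(X)) (ĝ_k(X) - g₀(X))] → 0` in probability
    (hbias : TendstoInProbOverFolds P (fun (n : ℕ) (k : Fin (K n)) (ω : Ω) =>
      √(n : ℝ) * ∫ z,
        (a₀ (X z) - ahat n k (outOfFold (fold n) (fun i : Fin n => Z i ω) k) (X z)) *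
        (ghat n k (outOfFold (fold n) (fun i : Fin n => Z i ω) k) (X z) - g₀ (X z)) ∂ν))
    -- the random norms `‖â_k - a_*‖₂` and `‖ĝ_k - g_*‖₂` tend to `0` in `L²`
    (hastar : Measurable astar) (hgstar : Measurable gstar)
    (hahat_lim : TendstoInL2OverFolds P (fun (n : ℕ) (k : Fin (K n)) (ω : Ω) =>
      eLpNorm (fun z => ahat n k (outOfFold (fold n) (fun i : Fin n => Z i ω) k) (X z)
        - astar (X z)) 2 ν))
    (hghat_lim : TendstoInL2OverFolds P (fun (n : ℕ) (k : Fin (K n)) (ω : Ω) =>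
      eLpNorm (fun z => ghat n k (outOfFold (fold n) (fun i : Fin n => Z i ω) k) (X z)
        - gstar (X z)) 2 ν))
    -- mean-squared continuity, boundedness, and finiteness of the asymptotic variance
    (hmsc : MeanSquaredContinuousOn ν X m (starHull (diffClass (insert gstar 𝒢))))
    (hbdd : ∃ C : ℝ, (∀ᵐ z ∂ν, |Y z| ≤ C) ∧ (∀ g ∈ 𝒢, ∀ᵐ z ∂ν, |g (X z)| ≤ C) ∧
      (∀ a ∈ 𝒜, ∀ᵐ z ∂ν, |a (X z)| ≤ C))
    (hvar : MemLp (debiasedMoment X Y m astar gstar) 2 ν) :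
    TendstoInDistribution
      (fun (n : ℕ) (ω : Ω) => √(n : ℝ) *
        (crossFitEstimate X Y m (fold n) (ahat n) (ghat n) (fun i : Fin n => Z i ω)
          - momentFunctional ν m g₀))
      atTop (id : ℝ → ℝ) (fun _ => P)
      (gaussianReal 0 (Var[debiasedMoment X Y m astar gstar; ν]).toNNReal) := by
  have hS (n : ℕ) : HasLaw (fun ω (i : Fin n) => Z i ω) (Measure.pi fun _ : Fin n => ν) P :=
    (hZindep.precomp Fin.val_injective).hasLaw_pi fun i : Fin n => hZlaw i
  have hT (n : ℕ) (k : Fin (K n)) :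
      AEMeasurable (fun ω => outOfFold (fold n) (fun i : Fin n => Z i ω) k) P :=
    (measurable_outOfFold (fold n) k).comp_aemeasurable (hS n).aemeasurable
  obtain ⟨C₀, hYC₀, h𝒢C₀, h𝒜C₀⟩ := hbdd
  set C : ℝ≥0 := C₀.toNNReal
  have hC : C₀ ≤ C := Real.le_coe_toNNReal C₀
  have hYC : ∀ᵐ z ∂ν, |Y z| ≤ C := hYC₀.mono fun _ h => h.trans hC
  have h𝒢C : ∀ g ∈ 𝒢, ∀ᵐ z ∂ν, |g (X z)| ≤ C := fun g hg => (h𝒢C₀ g hg).mono fun _ h => h.trans hC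
  have h𝒜C : ∀ a ∈ 𝒜, ∀ᵐ z ∂ν, |a (X z)| ≤ C := fun a ha => (h𝒜C₀ a ha).mono fun _ h => h.trans hC
  -- `astar` need not lie in `𝒜`; it inherits the bound as an `L²` limit of realised estimates.
  have hastarC : ∀ᵐ z ∂ν, |astar (X z)| ≤ C := by
    refine ae_abs_le_of_forall_exists_eLpNorm_lt (hastar.comp hX) fun ε hε => ?_
    obtain ⟨n, k, ω, h⟩ := hahat_lim.exists_lt fold hε
    exact ⟨_, (h𝒜 _ (hahat_mem n k _)).comp hX, h𝒜C _ (hahat_mem n k _), h⟩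
  obtain ⟨M, hM⟩ := hmsc
  obtain ⟨B, hB⟩ : ∃ B : ℕ, ∀ᶠ n in atTop, K n ≤ B := by
    obtain ⟨c, hc⟩ := hK.1.bound
    obtain ⟨B, hB⟩ := exists_nat_ge c
    refine ⟨B, hc.mono fun n hn => ?_⟩
    have : (K n : ℝ) ≤ c := by simpa using hn
    exact_mod_cast this.trans hB
  have hYL : MemLp Y 2 ν := MemLp.of_bound hY.aestronglyMeasurable C hYC
  -- a measurable version of the limiting moment
  set ψ : 𝒵 → ℝ := hvar.1.mk
  have hψm : Measurable ψ := hvar.1.stronglyMeasurable_mk.measurable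
  have hψ : debiasedMoment X Y m astar gstar =ᵐ[ν] ψ := hvar.1.ae_eq_mk
  have hψL : MemLp ψ 2 ν := (memLp_congr_ae hψ).1 hvar
  have hmstar : AEStronglyMeasurable (fun z => m z gstar) ν := by
    have h : AEStronglyMeasurable (fun z => astar (X z) * (Y z - gstar (X z))) ν :=
      ((hastar.comp hX).mul (hY.sub (hgstar.comp hX))).aestronglyMeasurable
    refine (hvar.1.sub h).congr (ae_of_all _ fun z => ?_)
    simp [debiasedMoment]
  -- the estimated moment and its deviation from the limit
  let D (n : ℕ) (k : Fin (K n)) (d : {j : Fin n // fold n j ≠ k} → 𝒵) : 𝒵 → ℝ :=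
    debiasedMoment X Y m (ahat n k d) (ghat n k d)
  let F (n : ℕ) (k : Fin (K n)) (d : {j : Fin n // fold n j ≠ k} → 𝒵) (z : 𝒵) : ℝ :=
    D n k d z - ψ z
  have hD (n k) : Measurable (Function.uncurry (D n k)) := by
    have hX' : Measurable fun p : ({j : Fin n // fold n j ≠ k} → 𝒵) × 𝒵 => (p.1, X p.2) :=
      measurable_fst.prodMk (hX.comp measurable_snd)
    exact (hm_meas n k).add (((hahat_meas n k).comp hX').mul
      ((hY.comp measurable_snd).sub ((hghat_meas n k).comp hX')))
  have hF (n k) : Measurable (Function.uncurry (F n k)) := (hD n k).sub (hψm.comp measurable_snd)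
  have hbiasD (n k d) := integral_debiasedMoment_sub_momentFunctional hX hYL hg₀ ha₀
    (hghat_mem n k d) (h𝒜 _ (hahat_mem n k d)) (h𝒜C _ (hahat_mem n k d))
    (MemLp.of_bound ((h𝒢 _ (hghat_mem n k d)).comp hX).aestronglyMeasurable C
      (h𝒢C _ (hghat_mem n k d)))
  have hFint (n k d) : ∫ z, F n k d z ∂ν = ∫ z, D n k d z ∂ν - ∫ z, ψ z ∂ν :=
    integral_sub (hbiasD n k d).1 (hψL.integrable one_le_two)
  have hFle (n k d) : eLpNorm (F n k d) 2 ν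
      ≤ (M + C : ℝ≥0) * eLpNorm (fun z => ghat n k d (X z) - gstar (X z)) 2 ν
        + (2 * C : ℝ≥0) * eLpNorm (fun z => ahat n k d (X z) - astar (X z)) 2 ν := by
    have hg := hghat_mem n k d
    have hlin' (z : 𝒵) : m z (ghat n k d - gstar) = m z (ghat n k d) - m z gstar := by
      have := hlin z (ghat n k d) (Submodule.subset_span (Or.inl hg)) gstar
        (Submodule.subset_span (Or.inr (by simp))) 1 (-1)
      simpa [← sub_eq_add_neg] using this
    -- Mean-squared continuity at `r = 1`.
    have hm := hM (ghat n k d - gstar) ⟨1, by simp, _,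
      ⟨_, Set.mem_insert_of_mem _ hg, _, Set.mem_insert _ _, rfl⟩, by simp⟩
    simp only [hlin', Pi.sub_apply] at hm
    have h := eLpNorm_debiasedMoment_sub_le hX hY (h𝒜 _ (hahat_mem n k d)) (h𝒢 _ hg) hastar hgstar
      hYC (h𝒢C _ hg) hastarC (ha₀.2.2 _ (Set.mem_insert_of_mem _ hg)).1.1 hmstar hm
    refine (eLpNorm_congr_ae ?_).trans_le h
    filter_upwards [hψ] with z hz
    simp only [F, D, hz]
  -- uniform second moment bound over the folds
  let δ (n : ℕ) : ℝ≥0∞ := 2 * ((M + C : ℝ≥0) : ℝ≥0∞) ^ 2 *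
      (⨆ k : Fin (K n), ∫⁻ ω, eLpNorm (fun z =>
        ghat n k (outOfFold (fold n) (fun i : Fin n => Z i ω) k) (X z) - gstar (X z)) 2 ν ^ 2 ∂P)
    + 2 * ((2 * C : ℝ≥0) : ℝ≥0∞) ^ 2 * (⨆ k : Fin (K n), ∫⁻ ω, eLpNorm (fun z =>
        ahat n k (outOfFold (fold n) (fun i : Fin n => Z i ω) k) (X z) - astar (X z)) 2 ν ^ 2 ∂P)
  have hδ : Tendsto δ atTop (𝓝 0) := by
    have h1 := ENNReal.Tendsto.const_mul (a := 2 * ((M + C : ℝ≥0) : ℝ≥0∞) ^ 2) hghat_lim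
      (Or.inr (by finiteness))
    have h2 := ENNReal.Tendsto.const_mul (a := 2 * ((2 * C : ℝ≥0) : ℝ≥0∞) ^ 2) hahat_lim
      (Or.inr (by finiteness))
    simpa only [mul_zero, add_zero] using h1.add h2
  have hFδ (n : ℕ) (k : Fin (K n)) : ∫⁻ s, ∫⁻ z, ‖F n k (outOfFold (fold n) s k) z‖ₑ ^ 2 ∂ν
      ∂(Measure.pi fun _ : Fin n => ν) ≤ δ n := by
    have hm1 : Measurable fun d => ∫⁻ z, ‖F n k d z‖ₑ ^ 2 ∂ν :=
      Measurable.lintegral_prod_right (f := fun d z => ‖F n k d z‖ₑ ^ 2)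
        ((hF n k).enorm.pow_const 2)
    have hlaw := (hS n).lintegral_comp (hm1.comp (measurable_outOfFold (fold n) k)).aemeasurable
    simp only [Function.comp_apply] at hlaw
    rw [← hlaw]
    have hG : Measurable (Function.uncurry fun d z => ghat n k d (X z) - gstar (X z)) :=
      ((hghat_meas n k).comp (measurable_fst.prodMk (hX.comp measurable_snd))).sub
        (hgstar.comp (hX.comp measurable_snd))
    refine (lintegral_lintegral_enorm_sq_le (hT n k) hG (hFle n k)).trans ?_
    simp only [δ]
    gcongr
    · exact le_iSup (fun k : Fin (K n) => ∫⁻ ω, eLpNorm (fun z =>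
        ghat n k (outOfFold (fold n) (fun i : Fin n => Z i ω) k) (X z) - gstar (X z)) 2 ν ^ 2 ∂P) k
    · exact le_iSup (fun k : Fin (K n) => ∫⁻ ω, eLpNorm (fun z =>
        ahat n k (outOfFold (fold n) (fun i : Fin n => Z i ω) k) (X z) - astar (X z)) 2 ν ^ 2 ∂P) k
  -- the centred empirical process is negligible
  let r (n : ℕ) (s : Fin n → 𝒵) : ℝ := (√(n : ℝ))⁻¹ * ∑ k, ∑ i with fold n i = k,
    (F n k (outOfFold (fold n) s k) (s i) - ∫ z, F n k (outOfFold (fold n) s k) z ∂ν)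
  have hDout (n k) (i : Fin n) :
      Measurable fun s : Fin n → 𝒵 => D n k (outOfFold (fold n) s k) (s i) :=
    (hD n k).comp ((measurable_outOfFold (fold n) k).prodMk (measurable_pi_apply i))
  have hDmean (n k) : Measurable fun s : Fin n → 𝒵 => ∫ z, D n k (outOfFold (fold n) s k) z ∂ν :=
    ((hD n k).stronglyMeasurable.integral_prod_right).measurable.comp
      (measurable_outOfFold (fold n) k)
  have hrm (n : ℕ) : Measurable (r n) := by
    refine (Finset.measurable_fun_sum _ fun k _ => Finset.measurable_fun_sum _ fun i _ => ?_)
      |>.const_mul _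
    simp only [hFint]
    exact ((hDout n k i).sub (hψm.comp (measurable_pi_apply i))).sub
      ((hDmean n k).sub measurable_const)
  let R (n : ℕ) (ω : Ω) : ℝ := r n fun i => Z i ω
  have hRm (n : ℕ) : AEMeasurable (R n) P := (hrm n).comp_aemeasurable (hS n).aemeasurable
  have hR : TendstoInMeasure P R atTop fun _ => 0 := by
    refine tendstoInMeasure_zero_of_tendsto_lintegral_enorm_sq
      (fun n => (hRm n).aestronglyMeasurable) ?_
    have hlim := ENNReal.Tendsto.const_mul (a := (B : ℝ≥0∞)) hδ (Or.inr (by simp))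
    rw [mul_zero] at hlim
    refine tendsto_of_tendsto_of_tendsto_of_le_of_le' tendsto_const_nhds hlim
      (Eventually.of_forall fun n => zero_le) ?_
    filter_upwards [hB, eventually_gt_atTop 0] with n hn hn0
    have hsq : ‖(√(n : ℝ))⁻¹‖ₑ ^ 2 = (n : ℝ≥0∞)⁻¹ := by
      rw [← enorm_pow, inv_pow, Real.sq_sqrt (by positivity), Real.enorm_of_nonneg (by positivity),
        ENNReal.ofReal_inv_of_pos (by positivity), ENNReal.ofReal_natCast]
    have h0 : (n : ℝ≥0∞) ≠ 0 := by exact_mod_cast hn0.ne'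
    -- The normalisation `1/n` cancels the total of the fold sizes, leaving the number of folds
    -- times `δ n`.
    calc ∫⁻ ω, ‖R n ω‖ₑ ^ 2 ∂P = ∫⁻ s, ‖r n s‖ₑ ^ 2 ∂(Measure.pi fun _ : Fin n => ν) :=
          (hS n).lintegral_comp (f := fun s => ‖r n s‖ₑ ^ 2)
            ((hrm n).enorm.pow_const 2).aemeasurable
      _ ≤ (n : ℝ≥0∞)⁻¹ * (K n * (n * δ n)) := by
          simp only [r, enorm_mul, mul_pow, hsq]
          rw [lintegral_const_mul' _ _ (by simpa using h0)]
          gcongr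
          exact lintegral_enorm_sq_sum_folds_le ν (fold n) (hF n) (hFδ n)
      _ = K n * δ n := by
          rw [mul_left_comm, ← mul_assoc _ (n : ℝ≥0∞), ENNReal.inv_mul_cancel h0 (by simp),
            one_mul]
      _ ≤ B * δ n := by gcongr
  -- the bias is negligible
  let b (n : ℕ) (k : Fin (K n)) (s : Fin n → 𝒵) : ℝ :=
    ∫ z, D n k (outOfFold (fold n) s k) z ∂ν - momentFunctional ν m g₀
  let R' (n : ℕ) (ω : Ω) : ℝ := (√(n : ℝ))⁻¹ * ∑ k, ∑ i with fold n i = k, b n k fun i => Z i ω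
  have hR'm (n : ℕ) : AEMeasurable (R' n) P := by
    have h : Measurable fun s : Fin n → 𝒵 =>
        (√(n : ℝ))⁻¹ * ∑ k, ∑ i with fold n i = k, b n k s :=
      (Finset.measurable_fun_sum _ fun k _ => Finset.measurable_fun_sum _ fun i _ =>
        (hDmean n k).sub measurable_const).const_mul _
    exact h.comp_aemeasurable (hS n).aemeasurable
  have hR' : TendstoInMeasure P R' atTop fun _ => 0 := by
    refine tendstoInMeasure_sum_folds (b := fun n k ω => b n k fun i => Z i ω) hB fold ?_
    simp only [b, D, (hbiasD _ _ _).2]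
    exact hbias
  -- the oracle central limit theorem
  have hψlaw (i : ℕ) : HasLaw (fun ω => ψ (Z i ω)) (ν.map ψ) P :=
    (HasLaw.mk hψm.aemeasurable rfl).comp (hZlaw i)
  have hmean : ∫ ω, ψ (Z 0 ω) ∂P = ∫ z, ψ z ∂ν :=
    (hZlaw 0).integral_comp hψm.aestronglyMeasurable
  have hvarψ : Var[fun ω => ψ (Z 0 ω); P] = Var[debiasedMoment X Y m astar gstar; ν] := by
    rw [variance_congr hψ, ← (hZlaw 0).map_eq,
      variance_map hψm.aemeasurable (hZlaw 0).aemeasurable]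
    rfl
  have hclt := tendstoInDistribution_inv_sqrt_mul_sum_sub (P := P) (X := fun i ω => ψ (Z i ω))
    (Y := (id : ℝ → ℝ))
    (P' := gaussianReal 0 (Var[debiasedMoment X Y m astar gstar; ν]).toNNReal)
    (by rw [hvarψ]; exact HasLaw.id) ?_
    (hZindep.comp (fun _ => ψ) fun _ => hψm) fun i => (hψlaw i).identDistrib (hψlaw 0)
  swap
  · have h : MemLp ψ 2 (P.map (Z 0)) := by rw [(hZlaw 0).map_eq]; exact hψL
    exact h.comp_of_map (hZlaw 0).aemeasurable
  -- Slutsky, once for each negligible remainder.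
  have hsum := (hclt.add_of_tendstoInMeasure_const hR hRm).add_of_tendstoInMeasure_const hR' hR'm
  simp only [add_zero] at hsum
  refine hsum.congr (fun n => ae_of_all _ fun ω => ?_) (ae_of_all _ fun _ => rfl)
  have hdec := sqrt_mul_crossFit_decomposition (fold n)
    (fun k i => D n k (outOfFold (fold n) (fun i : Fin n => Z i ω) k) (Z i ω))
    (fun i => ψ (Z i ω))
    (fun k => ∫ z, D n k (outOfFold (fold n) (fun i : Fin n => Z i ω) k) z ∂ν)
    (momentFunctional ν m g₀) (∫ z, ψ z ∂ν)
  simp only [Pi.add_apply, R, r, R', hFint, hmean, Finset.sum_range]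
  simp only [F, b]
  rw [add_assoc, ← hdec]
  simp only [crossFitEstimate, D]
  ring
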